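/- Let $T$ be a (finite) tree. For $q,r\ge 0$ with $q+r\ge 1$, a generalized pendant path (gpp) $P_q\ast S_r$ of $T$ at a vertex $u$ with $\deg(u)\ge 3$ consists of a path of length $q$ from $u$ to a vertex $v$ (with $v=u$ if $q=0$) together with $r$ pendant paths of length $2$ attached at $v$, such that no vertex of it other than $u$ has further neighbours in $T$; it has $q+2r$ vertices besides $u$, and $u$ is called its attachment vertex. A $(P_q,S_r)$ representation of $T$ is a finite family of gpps of $T$ such that: distinct gpps have no vertex in common other than possibly their attachment vertices; no attachment vertex is a non-attachment vertex of a gpp of the family; every leaf of $T$ is a non-attachment vertex of some gpp of the family; and, if only one gpp of the family is attached at $u$, then $u$ has at least two neighbours outside that gpp. A vertex $u$ is starlike for the representation if $\deg(u)\ge 3$ and at least two gpps of the family are attached at $u$. For a tree $T$ of order $n$ let $\sigma(T)$ be the number of eigenvalues of its Laplacian matrix, counted with multiplicity, that are larger than the average degree $2-\frac2n$. We say that $T$ can be properly transformed into a tree $T'$ if $T'$ has the same number of vertices as $T$ and $\sigma(T)\le\sigma(T')$. For $n=4r+\alpha\ge 8$ with $\alpha\in\{0,1,2,3\}$, the prototype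 tree $T_\alpha$ of order $n$ consists of a vertex $u$ with two gpp-shaped branches $P_q\ast S_r$ attached at $u$, as follows (here no condition on the degree of $u$ is imposed): $T_0=u+P_0\ast S_{r-1}\oplus P_1\ast S_r$, $\;T_1=u+P_0\ast S_r\oplus P_0\ast S_r$, $\;T_2=u+P_0\ast S_r\oplus P_1\ast S_r$, $\;T_3=u+P_1\ast S_r\oplus P_1\ast S_r$. Theorem. Let $T$ be a tree of order $n\ge 8$ with a $(P_q,S_r)$ representation that has exactly one starlike vertex. Then $T$ can be properly transformed into $T_\alpha$, where $\alpha\in\{0,1,2,3\}$ and $n\equiv\alpha\pmod 4$. -/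

import Mathlib

open Classical in
/-- The number of eigenvalues (with multiplicity) of the Laplacian matrix `D - A` of a tree `T`
that are larger than its average degree `2 - 2 / n`, where `n` is the order of `T`. -/
noncomputable def sigmaAbove {V : Type*} [Fintype V] (T : SimpleGraph V) : ℕ :=
  (Finset.univ.filter fun i : V =>
    (2 : ℝ) - 2 / (Fintype.card V : ℝ) <
      (SimpleGraph.posSemidef_lapMatrix ℝ T).isHermitian.eigenvalues i).card

/-- `T` is properly transformed into `T'`: the result `T'` is a tree with the same number of
vertices, and the number of Laplacian eigenvalues above the average degree does not decrease. -/
def ProperlyTransforms {V W : Type*} [Fintype V] [Fintype W]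
    (T : SimpleGraph V) (T' : SimpleGraph W) : Prop :=
  T'.IsTree ∧ Fintype.card V = Fintype.card W ∧ sigmaAbove T ≤ sigmaAbove T'

/-- The vertices, other than the attachment vertex `u`, of a generalized pendant path
`P_q * S_r` at `u`: first the `q` vertices of the path that leaves `u`, then the `r` middle
vertices and the `r` end vertices of the pendant paths of length 2 at the far end of the path. -/
abbrev GppVertex (q r : ℕ) : Type := Fin q ⊕ Fin r ⊕ Fin r

/-- The neighbour of a vertex of `P_q * S_r` in the direction of the attachment vertex `u`;
the value `none` stands for `u` itself. -/
def GppVertex.parent {q r : ℕ} : GppVertex q r → Option (GppVertex q r)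
  | .inl j => if (j : ℕ) = 0 then none else some (.inl ⟨(j : ℕ) - 1, by omega⟩)
  | .inr (.inl _) => if h : 0 < q then some (.inl ⟨q - 1, by omega⟩) else none
  | .inr (.inr k) => some (.inr (.inl k))

/-- The parent map of `u + P_{q₁} * S_{r₁} ⊕ ⋯ ⊕ P_{q_L} * S_{r_L}`, rooted at `u = none`. -/
def gppSumParent {L : ℕ} (q r : Fin L → ℕ) :
    Option (Σ i : Fin L, GppVertex (q i) (r i)) →
      Option (Option (Σ i : Fin L, GppVertex (q i) (r i)))
  | none => none
  | some ⟨i, x⟩ => some (x.parent.map fun y => ⟨i, y⟩)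

/-- The tree `u + P_{q₁} * S_{r₁} ⊕ ⋯ ⊕ P_{q_L} * S_{r_L}`. -/
def gppSum {L : ℕ} (q r : Fin L → ℕ) :
    SimpleGraph (Option (Σ i : Fin L, GppVertex (q i) (r i))) :=
  SimpleGraph.fromRel fun x y => gppSumParent q r x = some y

/-- The lengths `q₁, q₂` in the prototype tree `T_α`. -/
def prototypeQ : Fin 4 → Fin 2 → ℕ
  | 0 => ![0, 1]
  | 1 => ![0, 0]
  | 2 => ![0, 1]
  | 3 => ![1, 1]

/-- The numbers of rays `r₁, r₂` in the prototype tree `T_α` of order `4 * r + α`. -/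
def prototypeR (r : ℕ) : Fin 4 → Fin 2 → ℕ
  | 0 => ![r - 1, r]
  | 1 => ![r, r]
  | 2 => ![r, r]
  | 3 => ![r, r]

/-- The prototype tree `T_α` of order `4 * r + α` (for `r ≥ 1`):
`T₀ = u + P₀ * S_{r-1} ⊕ P₁ * S_r`, `T₁ = u + P₀ * S_r ⊕ P₀ * S_r`,
`T₂ = u + P₀ * S_r ⊕ P₁ * S_r`, `T₃ = u + P₁ * S_r ⊕ P₁ * S_r`. -/
def prototypeTree (r : ℕ) (α : Fin 4) :
    SimpleGraph (Option (Σ i : Fin 2, GppVertex (prototypeQ α i) (prototypeR r α i))) :=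
  gppSum (prototypeQ α) (prototypeR r α)

/-- A `(P_q, S_r)` representation of a tree `T`: a family of generalized pendant paths
`P_{q i} * S_{r i}` of `T` attached at vertices `root i`, which reach all leaves of `T`. -/
structure GppRepresentation {V : Type*} (T : SimpleGraph V) where
  /-- the number of generalized pendant paths -/
  count : ℕ
  q : Fin count → ℕ
  r : Fin count → ℕ
  root : Fin count → V
  /-- the vertices of the generalized pendant paths, without their attachment vertices -/
  vert : (i : Fin count) → GppVertex (q i) (r i) → V
  one_le : ∀ i, 1 ≤ q i + r i
  three_le_degree : ∀ i, 3 ≤ (T.neighborSet (root i)).ncard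
  /-- distinct generalized pendant paths are disjoint up to attachment vertices -/
  injective : Function.Injective
    fun x : Σ i : Fin count, GppVertex (q i) (r i) => vert x.1 x.2
  root_ne : ∀ i j x, root i ≠ vert j x
  /-- inside `T`, the neighbours of a vertex of `P_q * S_r` are exactly those that it has in
  `P_q * S_r`; so only the attachment vertex can have further neighbours -/
  adj_iff : ∀ i (x : GppVertex (q i) (r i)) (w : V), T.Adj (vert i x) w ↔
    w = x.parent.elim (root i) (vert i) ∨ ∃ y, GppVertex.parent y = some x ∧ w = vert i y
  /-- every leaf of `T`, hence every pendant path, lies in a generalized pendant path -/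
  leaf_mem : ∀ w, (T.neighborSet w).ncard = 1 → ∃ i x, vert i x = w
  /-- generalized pendant paths are collapsed as far as possible: a vertex at which only one of
  them is attached is not itself the end of a path that leads to it from the rest of `T` -/
  collapsed : ∀ i, (∀ j, root j = root i → j = i) →
    2 ≤ {w | T.Adj (root i) w ∧ ∀ x, w ≠ vert i x}.ncard

/-- A starlike vertex of a representation: a vertex of degree at least 3 at which at least two
generalized pendant paths are attached. -/
def GppRepresentation.IsStarlike {V : Type*} {T : SimpleGraph V} (R : GppRepresentation T)
    (u : V) : Prop :=
  3 ≤ (T.neighborSet u).ncard ∧ ∃ i j, i ≠ j ∧ R.root i = u ∧ R.root j = u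

/-! A vertex outside all generalized pendant paths (gpps) that is farthest from the starlike vertex
`u` must be `u` itself, so `T` is the sum of its gpps at `u`. It then suffices that every such sum
has σ ≤ ⌊n/2⌋, while the prototype has σ ≥ ⌊n/2⌋.

Put d = 2/n, so that the threshold is 2 - d. Completing squares from the leaves to the root
diagonalizes the form of L - (2 - d); a child with pivot a passes 1 - 1/a to its parent. The exact
pivots are not needed: trial weights that are everywhere at least (at most) the value eliminated
from the weights of the children bound σ from above (below) by the number of positive weights. These
are `sigmaAbove_le` and `le_sigmaAbove`.

For the upper bound, each gpp is compared with a share of d per vertex; the shares add up to d(n -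
1) = 2 - d, exactly what is subtracted at `u`. In a gpp with q even, half of the weights are
positive and at most the share is passed on. For q odd one sign is left over, the `excess` ±1.
`sum_excess_add_le` shows that the excesses and a positive weight at `u` together never push the
count above n/2. For the lower bound on the prototype, constant weights on each kind of vertex
suffice. -/

open Matrix in
/-- Eigenvectors whose number exceeds the number of given linear conditions have a nontrivial
combination that satisfies these conditions. -/
theorem Matrix.IsHermitian.exists_combination {V ι : Type*} [Fintype V] [DecidableEq V] [Fintype ι]
    {A : Matrix V V ℝ} (hA : A.IsHermitian) (S : Finset V) (L : (V → ℝ) →ₗ[ℝ] (ι → ℝ))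
    (h : Fintype.card ι < S.card) :
    ∃ x : V → ℝ, L x = 0 ∧ ∃ c : V → ℝ, (∀ i ∉ S, c i = 0) ∧ (∃ i ∈ S, c i ≠ 0) ∧
      x ⬝ᵥ x = ∑ i, c i ^ 2 ∧ x ⬝ᵥ A *ᵥ x = ∑ i, hA.eigenvalues i * c i ^ 2 := by
  let U : Matrix V V ℝ := hA.eigenvectorUnitary
  let E : (S → ℝ) →ₗ[ℝ] (V → ℝ) := Function.ExtendByZero.linearMap ℝ (fun i : S => (i : V))
  have hk : LinearMap.ker (L ∘ₗ U.mulVecLin ∘ₗ E) ≠ ⊥ :=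
    LinearMap.ker_ne_bot_of_finrank_lt (by simpa using h)
  obtain ⟨c, hc, hc0⟩ := Submodule.exists_mem_ne_zero_of_ne_bot hk
  have hE : ∀ i : S, E c i = c i := fun i =>
    Subtype.val_injective.extend_apply c 0 i
  have hU : Uᵀ * U = 1 := by
    have := Unitary.coe_star_mul_self hA.eigenvectorUnitary
    simpa [U, star_eq_conjTranspose] using this
  have hA' : Uᵀ * A * U = diagonal hA.eigenvalues := by
    have := hA.conjStarAlgAut_star_eigenvectorUnitary
    rw [Unitary.conjStarAlgAut_star_apply] at this
    simpa [U, star_eq_conjTranspose, Function.comp_def] using this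
  refine ⟨U *ᵥ E c, by simpa using hc, E c, fun i hi => ?_, ?_, ?_, ?_⟩
  · exact Function.extend_apply' _ _ _ (by rintro ⟨a, rfl⟩; exact hi a.2)
  · obtain ⟨i, hi⟩ := Function.ne_iff.mp hc0
    exact ⟨i, i.2, by rw [hE]; exact hi⟩
  · rw [dotProduct_mulVec, vecMul_mulVec, ← dotProduct_mulVec, hU, one_mulVec]
    simp [dotProduct, sq]
  · rw [mulVec_mulVec, ← vecMul_transpose, ← dotProduct_mulVec, mulVec_mulVec,
      ← Matrix.mul_assoc, hA']
    simp only [dotProduct, mulVec_diagonal]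
    exact Finset.sum_congr rfl fun i _ => by ring

/-! ### Diagonalization of L - m along a rooted forest, with inequalities -/

/-- `p` is the parent map of a rooting of the forest `T`. -/
structure SimpleGraph.IsParentMap {V : Type*} (T : SimpleGraph V) (p : V → Option V) : Prop where
  adj_iff : ∀ x y, T.Adj x y ↔ p x = some y ∨ p y = some x
  exists_depth : ∃ d : V → ℕ, ∀ x y, p x = some y → d y < d x

namespace SimpleGraph.IsParentMap

open Matrix

variable {V : Type*} [Fintype V] [DecidableEq V] {T : SimpleGraph V} {p : V → Option V}

theorem sum_elim (p : V → Option V) (v : V) (f : V → ℝ) :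
    ∑ w, (if p v = some w then f w else 0) = (p v).elim 0 f := by
  cases h : p v with
  | none => simp
  | some u => simp

/-- The result of eliminating all children of `v` with the weights `a` from the form `L - m`. -/
noncomputable def eliminated (p : V → Option V) (m : ℝ) (a : V → ℝ) (v : V) : ℝ :=
  ∑ w, (if p w = some v then 1 - 1 / a w else 0) + (if p v = none then 0 else 1) - m

theorem lapMatrix_form [DecidableRel T.Adj] (h : T.IsParentMap p) (x : V → ℝ) :
    x ⬝ᵥ (T.lapMatrix ℝ) *ᵥ x = ∑ v, (p v).elim 0 fun w => (x v - x w) ^ 2 := by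
  obtain ⟨d, hd⟩ := h.exists_depth
  have key : ∀ i j, (if T.Adj i j then (x i - x j) ^ 2 else 0) =
      (if p i = some j then (x i - x j) ^ 2 else 0) +
      (if p j = some i then (x j - x i) ^ 2 else 0) := fun i j => by
    by_cases h1 : p i = some j <;> by_cases h2 : p j = some i
    · exact absurd (hd _ _ h1) (hd _ _ h2).not_gt
    all_goals simp [h.adj_iff, h1, h2]
    ring
  rw [← toLinearMap₂'_apply', lapMatrix_toLinearMap₂']
  simp_rw [key, Finset.sum_add_distrib]
  rw [Finset.sum_comm (f := fun i j => if p j = some i then (x j - x i) ^ 2 else 0)]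
  simp_rw [sum_elim p _ fun w => (x _ - x w) ^ 2]
  ring

/-- Completing the square at `v` turns (x_v - x_w)², with `w` the parent, into a pivot square plus
(1 - 1/a_v) x_w², which is handed to `w`. The identity holds for arbitrary weights; the second sum
records how far they are from the exact pivots. -/
theorem lapMatrix_form_eq [DecidableRel T.Adj] (h : T.IsParentMap p) (m : ℝ) (a : V → ℝ)
    (ha : ∀ v, p v ≠ none → a v ≠ 0) (x : V → ℝ) :
    x ⬝ᵥ (T.lapMatrix ℝ) *ᵥ x - m * (x ⬝ᵥ x) =
      ∑ v, a v * (x v - (p v).elim 0 x / a v) ^ 2 +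
        ∑ v, (eliminated p m a v - a v) * x v ^ 2 := by
  have e : ∑ v, (∑ w, (if p w = some v then 1 - 1 / a w else 0)) * x v ^ 2 =
      ∑ w, (p w).elim 0 fun v => (1 - 1 / a w) * x v ^ 2 := by
    simp_rw [Finset.sum_mul]
    rw [Finset.sum_comm]
    refine Finset.sum_congr rfl fun w _ => ?_
    rw [← sum_elim p w]
    exact Finset.sum_congr rfl fun v _ => by split_ifs <;> simp
  have e2 : ∑ v, (eliminated p m a v - a v) * x v ^ 2 =
      ∑ v, ((p v).elim 0 (fun w => (1 - 1 / a v) * x w ^ 2) +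
        ((if p v = none then 0 else 1) - m - a v) * x v ^ 2) := by
    rw [Finset.sum_add_distrib, ← e, ← Finset.sum_add_distrib]
    exact Finset.sum_congr rfl fun v _ => by rw [eliminated]; ring
  rw [h.lapMatrix_form, e2, ← Finset.sum_add_distrib, dotProduct, Finset.mul_sum,
    ← Finset.sum_sub_distrib]
  refine Finset.sum_congr rfl fun v _ => ?_
  cases hv : p v with
  | none => simp; ring
  | some w =>
    have := ha v (by simp [hv])
    simp only [Option.elim_some, reduceCtorEq, if_false]
    field_simp
    ring

/-- The linear forms which diagonalize `L - m`, restricted to a set of vertices. -/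
noncomputable def pivotForms (p : V → Option V) (a : V → ℝ) (P : Finset V) :
    (V → ℝ) →ₗ[ℝ] (P → ℝ) where
  toFun x v := x v - (p v).elim 0 x / a v
  map_add' x y := by
    ext v
    cases h : p v <;> simp [h]
    ring
  map_smul' c x := by
    ext v
    cases h : p v <;> simp [h]
    ring

theorem pivotForms_eq_zero {V : Type*} {p : V → Option V} {a : V → ℝ} {P : Finset V} {x : V → ℝ} (hx : pivotForms p a P x = 0)
    {v : V} (hv : v ∈ P) : x v - (p v).elim 0 x / a v = 0 :=
  congrFun hx ⟨v, hv⟩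

/-- If more eigenvalues exceeded m than weights are positive, some nonzero combination of their
eigenvectors would annihilate all positive squares. The form of L - m would be nonpositive there,
yet positive on that eigenspace. A zero weight is harmless at a root, where nothing is divided by
it. -/
theorem sigmaAbove_le (h : T.IsParentMap p) (a : V → ℝ) (ha : ∀ v, p v ≠ none → a v ≠ 0)
    (hle : ∀ v, eliminated p (2 - 2 / (Fintype.card V : ℝ)) a v ≤ a v) :
    sigmaAbove T ≤ (Finset.univ.filter fun v => 0 < a v).card := by
  classical
  set m := (2 : ℝ) - 2 / (Fintype.card V : ℝ) with hm
  by_contra! hlt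
  have e3 : sigmaAbove T = (Finset.univ.filter fun i : V =>
    m < (SimpleGraph.posSemidef_lapMatrix ℝ T).isHermitian.eigenvalues i).card := by
    unfold sigmaAbove; congr!
  have hlt' : Fintype.card (Finset.univ.filter fun v => 0 < a v) < (Finset.univ.filter fun i : V =>
      m < (SimpleGraph.posSemidef_lapMatrix ℝ T).isHermitian.eigenvalues i).card := by
    rwa [Fintype.card_coe, ← e3]
  obtain ⟨x, hx, c, hc0, ⟨i, hi, hci⟩, hxx, hxA⟩ := IsHermitian.exists_combination
    (SimpleGraph.posSemidef_lapMatrix ℝ T).isHermitian _ (pivotForms p a _) hlt'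
  have h1 := h.lapMatrix_form_eq m a ha x
  have h2 : ∑ v, a v * (x v - (p v).elim 0 x / a v) ^ 2 ≤ 0 :=
    Finset.sum_nonpos fun v _ => by
      by_cases hv : 0 < a v
      · rw [pivotForms_eq_zero hx (by simpa using hv)]; simp
      · exact mul_nonpos_of_nonpos_of_nonneg (not_lt.mp hv) (sq_nonneg _)
  have h3 : ∑ v, (eliminated p m a v - a v) * x v ^ 2 ≤ 0 :=
    Finset.sum_nonpos fun v _ =>
      mul_nonpos_of_nonpos_of_nonneg (sub_nonpos.mpr (hle v)) (sq_nonneg _)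
  have h4 : m * (x ⬝ᵥ x) < x ⬝ᵥ (T.lapMatrix ℝ) *ᵥ x := by
    rw [hxx, Finset.mul_sum]
    refine lt_of_lt_of_eq (Finset.sum_lt_sum (fun j _ => ?_) ⟨i, Finset.mem_univ _, ?_⟩) hxA.symm
    · by_cases hj : j ∈ Finset.univ.filter fun i : V =>
        m < (SimpleGraph.posSemidef_lapMatrix ℝ T).isHermitian.eigenvalues i
      · exact mul_le_mul_of_nonneg_right (Finset.mem_filter.mp hj).2.le (sq_nonneg _)
      · rw [hc0 j hj]; simp
    · exact mul_lt_mul_of_pos_right (Finset.mem_filter.mp hi).2 (by positivity)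
  linarith

/-- The dual count, with eigenvalues at most m and nonpositive weights. Neither side is strict now,
so the contradiction has to come from the equality case, which needs nonzero weights at the roots
too. -/
theorem le_sigmaAbove (h : T.IsParentMap p) (a : V → ℝ) (ha : ∀ v, a v ≠ 0)
    (hle : ∀ v, a v ≤ eliminated p (2 - 2 / (Fintype.card V : ℝ)) a v) :
    (Finset.univ.filter fun v => 0 < a v).card ≤ sigmaAbove T := by
  classical
  set m := (2 : ℝ) - 2 / (Fintype.card V : ℝ) with hm
  by_contra! hlt
  have e1 := Finset.card_filter_add_card_filter_not (s := (Finset.univ : Finset V)) fun v => 0 < a v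
  have e2 := Finset.card_filter_add_card_filter_not (s := (Finset.univ : Finset V)) fun i : V =>
    m < (SimpleGraph.posSemidef_lapMatrix ℝ T).isHermitian.eigenvalues i
  have e3 : sigmaAbove T = (Finset.univ.filter fun i : V =>
    m < (SimpleGraph.posSemidef_lapMatrix ℝ T).isHermitian.eigenvalues i).card := by
    unfold sigmaAbove; congr!
  have hlt' : Fintype.card (Finset.univ.filter fun v => ¬ 0 < a v) <
      (Finset.univ.filter fun i : V =>
        ¬ m < (SimpleGraph.posSemidef_lapMatrix ℝ T).isHermitian.eigenvalues i).card := by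
    rw [Fintype.card_coe]; omega
  obtain ⟨x, hx, c, hc0, ⟨i, hi, hci⟩, hxx, hxA⟩ := IsHermitian.exists_combination
    (SimpleGraph.posSemidef_lapMatrix ℝ T).isHermitian _ (pivotForms p a _) hlt'
  have h1 := h.lapMatrix_form_eq m a (fun v _ => ha v) x
  have h2' : ∀ v, 0 ≤ a v * (x v - (p v).elim 0 x / a v) ^ 2 := fun v => by
    by_cases hv : 0 < a v
    · positivity
    · rw [pivotForms_eq_zero hx (by simpa using hv)]; simp
  have h3 : 0 ≤ ∑ v, (eliminated p m a v - a v) * x v ^ 2 :=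
    Finset.sum_nonneg fun v _ => mul_nonneg (sub_nonneg.mpr (hle v)) (sq_nonneg _)
  have h4 : x ⬝ᵥ (T.lapMatrix ℝ) *ᵥ x ≤ m * (x ⬝ᵥ x) := by
    rw [hxx, Finset.mul_sum, hxA]
    refine Finset.sum_le_sum fun j _ => ?_
    by_cases hj : j ∈ Finset.univ.filter fun i : V =>
      ¬ m < (SimpleGraph.posSemidef_lapMatrix ℝ T).isHermitian.eigenvalues i
    · exact mul_le_mul_of_nonneg_right (not_lt.mp (Finset.mem_filter.mp hj).2) (sq_nonneg _)
    · rw [hc0 j hj]; simp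
  -- The form is squeezed to zero, hence every pivot square vanishes. Then x is zero at the roots
  -- and, by induction on the depth, everywhere.
  have h5 : ∀ v, x v = (p v).elim 0 x / a v := fun v => by
    have h6 : ∑ v, a v * (x v - (p v).elim 0 x / a v) ^ 2 = 0 :=
      le_antisymm (by linarith) (Finset.sum_nonneg fun v _ => h2' v)
    have := (Finset.sum_eq_zero_iff_of_nonneg fun v _ => h2' v).mp h6 v (Finset.mem_univ v)
    rcases mul_eq_zero.mp this with h7 | h7
    · exact absurd h7 (ha v)
    · linarith [pow_eq_zero_iff two_ne_zero |>.mp h7]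
  obtain ⟨d, hd⟩ := h.exists_depth
  have h0 : ∀ k v, d v < k → x v = 0 := by
    intro k
    induction k with
    | zero => intro v hv; omega
    | succ k ih =>
      intro v hv
      rw [h5 v]
      cases hp : p v with
      | none => simp
      | some w => simp [ih w (by have := hd v w hp; omega)]
  have hx0 : x = 0 := funext fun v => h0 _ v (Nat.lt_succ_self _)
  have h8 : ∑ i, c i ^ 2 = 0 := by rw [← hxx, hx0]; simp
  have := (Finset.sum_eq_zero_iff_of_nonneg fun i _ => sq_nonneg (c i)).mp h8 i (Finset.mem_univ i)
  exact hci (pow_eq_zero_iff two_ne_zero |>.mp this)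

/-- A finite graph with a parent map that has exactly one root is a tree. -/
theorem isTree (h : T.IsParentMap p) (u : V) (hu : ∀ v, p v = none ↔ v = u) : T.IsTree := by
  classical
  have hr : ∀ d : V → ℕ, (∀ x y, p x = some y → d y < d x) → ∀ k v, d v < k → T.Reachable v u := by
    intro d hd k
    induction k with
    | zero => intro v hv; omega
    | succ k ih =>
      intro v hv
      cases hp : p v with
      | none => rw [(hu v).mp hp]
      | some w =>
        exact ((h.adj_iff v w).mpr (Or.inl hp)).reachable.trans
          (ih w (by have := hd v w hp; omega))
  obtain ⟨d, hd⟩ := h.exists_depth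
  have hr' : ∀ v, T.Reachable v u := fun v => hr d hd _ v (Nat.lt_succ_self _)
  have hc : T.Connected :=
    { preconnected := fun v w => (hr' v).trans (hr' w).symm, nonempty := ⟨u⟩ }
  refine isTree_iff_connected_and_card.mpr ⟨hc, le_antisymm ?_ hc.card_vert_le_card_edgeSet_add_one⟩
  -- Each edge is determined by its lower endpoint, so there are at most |V| - 1 edges. The default
  -- value `u` is never taken, as the root is erased.
  have hsub : T.edgeSet ⊆
      ((Finset.univ.erase u).image fun v => s(v, (p v).getD u) : Finset (Sym2 V)) := by
    intro e
    induction e using Sym2.ind with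
    | _ x y =>
      intro hxy
      rw [mem_edgeSet, h.adj_iff] at hxy
      simp only [Finset.coe_image, Set.mem_image, Finset.coe_erase, Finset.coe_univ]
      rcases hxy with hxy | hxy
      · exact ⟨x, ⟨trivial, fun hx => by simp [(hu x).mpr hx] at hxy⟩, by simp [hxy]⟩
      · exact ⟨y, ⟨trivial, fun hx => by simp [(hu y).mpr hx] at hxy⟩, by simp [hxy, Sym2.eq_swap]⟩
  have h1 := Set.ncard_le_ncard hsub (Finset.finite_toSet _)
  rw [Set.ncard_coe_finset] at h1
  have h2 := h1.trans Finset.card_image_le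
  rw [Finset.card_erase_of_mem (Finset.mem_univ u), Finset.card_univ] at h2
  have : 0 < Fintype.card V := Fintype.card_pos_iff.mpr ⟨u⟩
  rw [Nat.card_eq_fintype_card (α := V)]
  change T.edgeSet.ncard + 1 ≤ _
  omega

end SimpleGraph.IsParentMap

/-! ### Invariance under isomorphism -/

-- The indexing of `eigenvalues` depends on the vertex type; the roots of the characteristic
-- polynomial do not.
open Classical in
theorem sigmaAbove_eq_card_roots {V : Type*} [Fintype V] (T : SimpleGraph V) :
    sigmaAbove T = ((T.lapMatrix ℝ).charpoly.roots.filter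
      fun t : ℝ => (2 : ℝ) - 2 / (Fintype.card V : ℝ) < t).card := by
  rw [(T.posSemidef_lapMatrix ℝ).isHermitian.roots_charpoly_eq_eigenvalues, Multiset.filter_map,
    Multiset.card_map]
  unfold sigmaAbove
  rw [Finset.card_def, Finset.filter_val]
  congr!

/-- Isomorphic graphs have the same number of Laplacian eigenvalues above the average degree. -/
theorem sigmaAbove_congr {V W : Type*} [Fintype V] [Fintype W] {T : SimpleGraph V}
    {T' : SimpleGraph W} (e : T ≃g T') : sigmaAbove T = sigmaAbove T' := by
  classical
  have hL : T'.lapMatrix ℝ = Matrix.reindex e.toEquiv e.toEquiv (T.lapMatrix ℝ) := by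
    ext i j
    obtain ⟨i, rfl⟩ := e.surjective i
    obtain ⟨j, rfl⟩ := e.surjective j
    have hd : T'.degree (e i) = T.degree i := e.degree_eq i
    have h1 : ∀ i, e.toEquiv.symm (e i) = i := e.symm_apply_apply
    simp [SimpleGraph.lapMatrix, SimpleGraph.degMatrix, Matrix.diagonal_apply,
      SimpleGraph.adjMatrix_apply, hd, h1, e.map_adj_iff]
  rw [sigmaAbove_eq_card_roots T, sigmaAbove_eq_card_roots T', Fintype.card_congr e.toEquiv]
  have := congrArg Matrix.charpoly hL
  rw [Matrix.charpoly_reindex] at this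
  congr! 3
  exact this.symm

/-! ### Sums over the children of a vertex of a single gpp -/

namespace GppVertex

variable {q r : ℕ}

/-- The distance to the attachment vertex. -/
def depth : GppVertex q r → ℕ
  | .inl j => j + 1
  | .inr (.inl _) => q + 1
  | .inr (.inr _) => q + 2

theorem depth_lt_of_parent_eq {x y : GppVertex q r} (h : x.parent = some y) :
    y.depth < x.depth := by
  rcases x with j | k | k
  · by_cases hj : (j : ℕ) = 0
    · simp [parent, hj] at h
    · simp only [parent, hj, if_false, Option.some.injEq] at h
      subst h
      simp only [depth]
      omega
  · by_cases hq : 0 < q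
    · simp only [parent, hq, dif_pos, Option.some.injEq] at h
      subst h
      simp only [depth]
      omega
    · simp [parent, hq] at h
  · simp only [parent, Option.some.injEq] at h
    subst h
    simp [depth]

theorem sum_eq (f : GppVertex q r → ℝ) :
    ∑ x, f x = ∑ j, f (.inl j) + (∑ k, f (.inr (.inl k)) + ∑ k, f (.inr (.inr k))) := by
  rw [Fintype.sum_sum_type, Fintype.sum_sum_type]

theorem sum_children_end (f : GppVertex q r → ℝ) (k : Fin r) :
    ∑ x : GppVertex q r, (if x.parent = some (.inr (.inr k)) then f x else 0) = 0 := by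
  refine Finset.sum_eq_zero fun x _ => if_neg fun h => ?_
  rcases x with j | k | k
  · by_cases hj : (j : ℕ) = 0 <;> simp [parent, hj] at h
  · by_cases hq : 0 < q <;> simp [parent, hq] at h
  · simp [parent] at h

theorem sum_children_middle (f : GppVertex q r → ℝ) (k : Fin r) :
    ∑ x : GppVertex q r, (if x.parent = some (.inr (.inl k)) then f x else 0) =
      f (.inr (.inr k)) := by
  rw [Finset.sum_eq_single (.inr (.inr k))]
  · simp [parent]
  · intro x _ hx
    refine if_neg fun h => ?_
    rcases x with j | k | k
    · by_cases hj : (j : ℕ) = 0 <;> simp [parent, hj] at h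
    · by_cases hq : 0 < q <;> simp [parent, hq] at h
    · simp only [parent, Option.some.injEq, Sum.inr.injEq, Sum.inl.injEq] at h
      exact hx (by rw [h])
  · simp

theorem sum_children_path_last (f : GppVertex q r → ℝ) (j : Fin q) (hj : (j : ℕ) + 1 = q) :
    ∑ x : GppVertex q r, (if x.parent = some (.inl j) then f x else 0) =
      ∑ k, f (.inr (.inl k)) := by
  have h0 : 0 < q := by omega
  rw [sum_eq, Finset.sum_eq_zero, zero_add, Finset.sum_eq_zero (f := fun k => ite _ (f (.inr (.inr k))) 0),
    add_zero]
  · refine Finset.sum_congr rfl fun k _ => if_pos ?_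
    simp only [parent, h0, dif_pos, Option.some.injEq, Sum.inl.injEq, Fin.ext_iff]
    omega
  · intro k _
    simp [parent]
  · intro i _
    refine if_neg fun h => ?_
    by_cases hi : (i : ℕ) = 0
    · simp [parent, hi] at h
    · simp only [parent, hi, if_false, Option.some.injEq, Sum.inl.injEq, Fin.ext_iff] at h
      omega

theorem sum_children_path (f : GppVertex q r → ℝ) (j : Fin q) (hj : (j : ℕ) + 1 < q) :
    ∑ x : GppVertex q r, (if x.parent = some (.inl j) then f x else 0) =
      f (.inl ⟨j + 1, hj⟩) := by
  rw [Finset.sum_eq_single (.inl ⟨j + 1, hj⟩)]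
  · simp [parent]
  · intro x _ hx
    refine if_neg fun h => ?_
    rcases x with i | k | k
    · by_cases hi : (i : ℕ) = 0
      · simp [parent, hi] at h
      · simp only [parent, hi, if_false, Option.some.injEq, Sum.inl.injEq, Fin.ext_iff] at h
        exact hx (congrArg _ (Fin.ext (by simp only; omega)))
    · by_cases hq : 0 < q
      · simp only [parent, hq, dif_pos, Option.some.injEq, Sum.inl.injEq, Fin.ext_iff] at h
        omega
      · simp [parent, hq] at h
    · simp [parent] at h
  · simp

theorem sum_top_of_eq_zero (f : GppVertex q r → ℝ) (hq : q = 0) :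
    ∑ x : GppVertex q r, (if x.parent = none then f x else 0) = ∑ k, f (.inr (.inl k)) := by
  subst hq
  rw [sum_eq]
  simp [parent]

theorem sum_top_of_pos (f : GppVertex q r → ℝ) (hq : 0 < q) :
    ∑ x : GppVertex q r, (if x.parent = none then f x else 0) = f (.inl ⟨0, hq⟩) := by
  rw [Finset.sum_eq_single (.inl ⟨0, hq⟩)]
  · simp [parent]
  · intro x _ hx
    refine if_neg fun h => ?_
    rcases x with i | k | k
    · by_cases hi : (i : ℕ) = 0
      · exact hx (congrArg _ (Fin.ext hi))
      · simp [parent, hi] at h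
    · simp [parent, hq] at h
    · simp [parent] at h
  · simp

end GppVertex

/-! ### Elimination on a sum of gpps -/

section gppSum

variable {L : ℕ} {q r : Fin L → ℕ}

theorem gppSum_isParentMap (q r : Fin L → ℕ) : (gppSum q r).IsParentMap (gppSumParent q r) := by
  have hd : ∀ x y, gppSumParent q r x = some y →
      y.elim 0 (fun z => z.2.depth) < x.elim 0 (fun z => z.2.depth) := by
    rintro (_ | ⟨i, x⟩) y h
    · simp [gppSumParent] at h
    · simp only [gppSumParent, Option.some.injEq] at h
      subst h
      cases hx : x.parent with
      | none => rcases x with j | k | k <;> simp [GppVertex.depth]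
      | some z => simpa using GppVertex.depth_lt_of_parent_eq hx
  refine ⟨fun x y => ?_, ⟨_, hd⟩⟩
  rw [gppSum, SimpleGraph.fromRel_adj]
  refine and_iff_right_of_imp ?_
  rintro (h | h) rfl <;> exact absurd (hd _ _ h) (lt_irrefl _)

theorem gppSumParent_eq_none {v} : gppSumParent q r v = none ↔ v = none := by
  cases v <;> simp [gppSumParent]

theorem gppSum_isTree (q r : Fin L → ℕ) : (gppSum q r).IsTree :=
  (gppSum_isParentMap q r).isTree none fun _ => gppSumParent_eq_none

theorem card_gppSum (q r : Fin L → ℕ) :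
    Fintype.card (Option (Σ i : Fin L, GppVertex (q i) (r i))) = ∑ i, (q i + 2 * r i) + 1 := by
  simp [two_mul]

open SimpleGraph.IsParentMap

theorem eliminated_none (m : ℝ) (a : Option (Σ i : Fin L, GppVertex (q i) (r i)) → ℝ) :
    eliminated (gppSumParent q r) m a none =
      ∑ i, ∑ x : GppVertex (q i) (r i), (if x.parent = none then 1 - 1 / a (some ⟨i, x⟩) else 0)
        - m := by
  simp only [eliminated, Fintype.sum_option, Fintype.sum_sigma, gppSumParent]
  simp

theorem eliminated_some (m : ℝ) (a : Option (Σ i : Fin L, GppVertex (q i) (r i)) → ℝ)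
    (i : Fin L) (y : GppVertex (q i) (r i)) :
    eliminated (gppSumParent q r) m a (some ⟨i, y⟩) =
      ∑ x : GppVertex (q i) (r i), (if x.parent = some y then 1 - 1 / a (some ⟨i, x⟩) else 0)
        + 1 - m := by
  simp only [eliminated, Fintype.sum_option, Fintype.sum_sigma, gppSumParent]
  rw [Finset.sum_eq_single i]
  · simp
  · intro j _ hj
    refine Finset.sum_eq_zero fun x _ => if_neg ?_
    cases x.parent <;> simp [hj]
  · simp

/-- Weights on the generalized pendant paths extended by a weight of the attachment vertex. -/
def gppSumWeight (g : (i : Fin L) → GppVertex (q i) (r i) → ℝ) (t : ℝ) :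
    Option (Σ i : Fin L, GppVertex (q i) (r i)) → ℝ
  | none => t
  | some ⟨i, x⟩ => g i x

theorem card_pos_gppSumWeight (g : (i : Fin L) → GppVertex (q i) (r i) → ℝ) (t : ℝ) :
    (Finset.univ.filter fun v => 0 < gppSumWeight g t v).card =
      (if 0 < t then 1 else 0) + ∑ i, ((Finset.univ.filter fun j => 0 < g i (.inl j)).card +
        ((Finset.univ.filter fun k => 0 < g i (.inr (.inl k))).card +
          (Finset.univ.filter fun k => 0 < g i (.inr (.inr k))).card)) := by
  rw [Finset.card_filter, Fintype.sum_option, Fintype.sum_sigma]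
  simp only [Finset.card_filter, Fintype.sum_sum_type, gppSumWeight]
  rfl

end gppSum

/-! ### Upper weights along the path of a gpp -/

/-- The weight `-1 + d (m + d / 2)` of a path vertex that separates `m` vertices (itself included)
at odd distance from the far end. -/
noncomputable def oddWeight (d : ℝ) (m : ℕ) : ℝ := -1 + d * (m + d / 2)

/-- The weight of the `k`-th vertex, counted from the far end, of the path of `P_q * S_r`. -/
noncomputable def pathWeight (d : ℝ) (r k : ℕ) : ℝ :=
  if Odd k then oddWeight d (2 * r + k) else d - 1 / oddWeight d (2 * r + k - 1)

/-- Upper weights for the generalized pendant path `P_q * S_r`. -/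
noncomputable def upperWeight (d : ℝ) {q r : ℕ} : GppVertex q r → ℝ
  | .inl j => pathWeight d r (q - j)
  | .inr (.inl _) => 1 / (1 - 2 * d)
  | .inr (.inr _) => d - 1

section

variable {n : ℕ} {d : ℝ}

/-- A zero would mean 2mn + 2 = n², impossible modulo 4. The correction d²/2 in `oddWeight` is what
excludes the zero at m = n/2. -/
theorem oddWeight_ne_zero (hn : 0 < n) (hd : d * n = 2) (m : ℕ) : oddWeight d m ≠ 0 := by
  intro h
  have hn' : (n : ℝ) ≠ 0 := by positivity
  have hd' : d = 2 / n := by field_simp; exact hd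
  have h1 : ((2 * m * n + 2 : ℕ) : ℝ) = ((n * n : ℕ) : ℝ) := by
    rw [oddWeight, hd'] at h
    field_simp at h
    push_cast
    linarith
  have h2 : 2 * m * n + 2 = n * n := by exact_mod_cast h1
  rcases Nat.even_or_odd' n with ⟨k, rfl | rfl⟩
  · have : 2 * (m * k) + 1 = 2 * (k * k) := by nlinarith
    omega
  · have : 2 * (m * (2 * k + 1) + 1) = 2 * (2 * k * k + 2 * k) + 1 := by nlinarith
    omega

theorem neg_one_lt_oddWeight (hd : 0 < d) (m : ℕ) : -1 < oddWeight d m := by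
  have : 0 < d * (m + d / 2) := by positivity
  rw [oddWeight]; linarith

theorem oddWeight_le (hd0 : 0 < d) (hd : d * n = 2) {m k : ℕ} (h : m + k ≤ n) :
    oddWeight d m ≤ 1 - d * k + d ^ 2 / 2 := by
  have : d * ((m : ℝ) + k) ≤ d * n := by gcongr; exact_mod_cast h
  rw [oddWeight]; nlinarith

/-- This makes d - 1/s and s = `oddWeight d m` have opposite signs whenever s ≠ 0. -/
theorem mul_oddWeight_lt_one (hd0 : 0 < d) (hd4 : d ≤ 1 / 4) (hd : d * n = 2) {m : ℕ} (h : m ≤ n) :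
    d * oddWeight d m < 1 := by
  have := oddWeight_le hd0 hd (k := 0) (by simpa using h)
  have : d * oddWeight d m ≤ d * 2 := by
    gcongr
    nlinarith
  linarith

theorem neg_one_div_sub_one_div {s : ℝ} (hs : s ≠ 0) (hds : d * s < 1) :
    -(1 / (d - 1 / s)) = s / (1 - d * s) := by
  have h1 : 1 - d * s ≠ 0 := by linarith
  have h2 : d - 1 / s = -((1 - d * s) / s) := by field_simp; ring
  rw [h2, one_div, inv_neg, neg_neg, inv_div]

theorem pathWeight_ne_zero (hd0 : 0 < d) (hd4 : d ≤ 1 / 4) (hd : d * n = 2) (hn : 0 < n)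
    {r k : ℕ} (h : 2 * r + k ≤ n) : pathWeight d r k ≠ 0 := by
  rw [pathWeight]
  split_ifs
  · exact oddWeight_ne_zero hn hd _
  · have h0 := oddWeight_ne_zero hn hd (2 * r + k - 1)
    have h1 := mul_oddWeight_lt_one hd0 hd4 hd (show 2 * r + k - 1 ≤ n by omega)
    intro h2
    field_simp at h2
    linarith

/-- The weights of the path satisfy the elimination inequality. -/
theorem sub_one_div_pathWeight_le (hd0 : 0 < d) (hd4 : d ≤ 1 / 4) (hd : d * n = 2) (hn : 0 < n)
    {r k : ℕ} (hk : 1 ≤ k) (h : 2 * r + k + 2 ≤ n) :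
    d - 1 / pathWeight d r k ≤ pathWeight d r (k + 1) := by
  by_cases hodd : Odd k
  · have h2 : ¬ Odd (k + 1) := by rw [Nat.odd_add_one]; exact not_not.mpr hodd
    rw [pathWeight, pathWeight, if_pos hodd, if_neg h2]
    exact le_rfl
  · have h2 : Odd (k + 1) := Nat.odd_add_one.mpr hodd
    obtain ⟨k, rfl⟩ : ∃ j, k = j + 1 := ⟨k - 1, by omega⟩
    rw [pathWeight, pathWeight, if_pos h2, if_neg hodd]
    have e : 2 * r + (k + 1) - 1 = 2 * r + k := by omega
    rw [e]
    set s := oddWeight d (2 * r + k) with hs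
    have hs0 : s ≠ 0 := oddWeight_ne_zero hn hd _
    have hds : d * s < 1 := mul_oddWeight_lt_one hd0 hd4 hd (by omega)
    have hs1 : -1 < s := neg_one_lt_oddWeight hd0 _
    have hs2 : s ≤ 1 - d * (3 : ℕ) + d ^ 2 / 2 := oddWeight_le hd0 hd (by omega)
    have e2 : oddWeight d (2 * r + (k + 1 + 1)) = s + 2 * d := by
      rw [hs, oddWeight, oddWeight]; push_cast; ring
    have h3 : s / (1 - d * s) ≤ s + d := by
      rw [div_le_iff₀ (by linarith)]
      -- Clearing the denominator 1 - d s and dividing by d reduces the claim to this.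
      have : s * (s + d) ≤ 1 := by
        push_cast at hs2
        have hs3 : s + d ≤ 1 := by nlinarith
        rcases le_total 0 s with h4 | h4
        · nlinarith
        · nlinarith
      nlinarith
    have h4 := neg_one_div_sub_one_div hs0 hds
    rw [e2]
    linarith

/-- The contribution to the attachment vertex of a path of even length. -/
theorem one_sub_one_div_pathWeight_le (hd0 : 0 < d) (hd4 : d ≤ 1 / 4) (hd : d * n = 2) (hn : 0 < n)
    {r k : ℕ} (hk : 1 ≤ k) (hodd : ¬ Odd k) (h : 2 * r + k + 1 ≤ n) :
    1 - 1 / pathWeight d r k ≤ d * (k + 2 * r) := by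
  obtain ⟨k, rfl⟩ : ∃ j, k = j + 2 := ⟨k - 2, by
    rcases Nat.lt_or_ge k 2 with h1 | h1
    · exact absurd (by rw [show k = 1 by omega]; exact odd_one) hodd
    · omega⟩
  rw [pathWeight, if_neg hodd]
  have e : 2 * r + (k + 2) - 1 = 2 * r + k + 1 := by omega
  rw [e]
  set s := oddWeight d (2 * r + k + 1) with hs
  have hs0 : s ≠ 0 := oddWeight_ne_zero hn hd _
  have hds : d * s < 1 := mul_oddWeight_lt_one hd0 hd4 hd (by omega)
  have hs1 : -1 + d ≤ s := by
    have : 0 ≤ d * (2 * r + k + d / 2) := by positivity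
    rw [hs, oddWeight]; push_cast; nlinarith
  have hs2 : s ≤ 1 - d * (2 : ℕ) + d ^ 2 / 2 := oddWeight_le hd0 hd (by omega)
  push_cast at hs2
  have hs2' : s ≤ 1 - 3 / 2 * d := by nlinarith
  have e2 : d * ((k + 2 : ℕ) + 2 * r : ℝ) = 1 + s + d - d * (d / 2) := by
    rw [hs, oddWeight]; push_cast; ring
  have h3 : s / (1 - d * s) ≤ s + d - d * (d / 2) := by
    rw [div_le_iff₀ (by linarith)]
    have h5 : s ^ 2 + d * s * (1 - d / 2) ≤ 1 - d / 2 := by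
      nlinarith [mul_nonneg (sub_nonneg.mpr hs1) (sub_nonneg.mpr hs2'), mul_pos hd0 hd0]
    nlinarith
  have h4 := neg_one_div_sub_one_div hs0 hds
  rw [e2]
  linarith

/-- Up to the last vertex the signs of the weights of the path alternate in pairs. -/
theorem card_pos_pathWeight_even (hd0 : 0 < d) (hd4 : d ≤ 1 / 4) (hd : d * n = 2) (hn : 0 < n)
    {r : ℕ} (t : ℕ) (h : 2 * r + 2 * t ≤ n) :
    ((Finset.range (2 * t)).filter fun k => 0 < pathWeight d r (k + 1)).card = t := by
  induction t with
  | zero => simp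
  | succ t ih =>
    have ih := ih (by omega)
    have h1 : pathWeight d r (2 * t + 1) = oddWeight d (2 * r + 2 * t + 1) := by
      rw [pathWeight, if_pos (by simp), ← add_assoc]
    have h2 : pathWeight d r (2 * t + 1 + 1) = d - 1 / oddWeight d (2 * r + 2 * t + 1) := by
      rw [pathWeight, if_neg (by simp [parity_simps])]
      rfl
    -- An odd position and the next even one carry s and d - 1/s, exactly one of which is positive.
    have h3 : 0 < pathWeight d r (2 * t + 1 + 1) ↔ ¬ 0 < pathWeight d r (2 * t + 1) := by
      rw [h1, h2]
      set s := oddWeight d (2 * r + 2 * t + 1)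
      have hs0 : s ≠ 0 := oddWeight_ne_zero hn hd _
      have hds : d * s < 1 := mul_oddWeight_lt_one hd0 hd4 hd (by omega)
      constructor
      · intro h4 h5
        have : 0 < (d - 1 / s) * s := mul_pos h4 h5
        field_simp at this
        linarith
      · intro h4
        have : 1 / s < 0 := one_div_neg.mpr (lt_of_le_of_ne (not_lt.mp h4) hs0)
        linarith
    rw [show 2 * (t + 1) = 2 * t + 1 + 1 by ring, Finset.range_add_one, Finset.range_add_one,
      Finset.filter_insert, Finset.filter_insert]
    by_cases h4 : 0 < pathWeight d r (2 * t + 1)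
    · rw [if_neg (by rw [h3]; exact not_not.mpr h4), if_pos h4, Finset.card_insert_of_notMem (by simp), ih]
    · rw [if_pos (h3.mpr h4), if_neg h4, Finset.card_insert_of_notMem (by simp), ih]

/-- Twice the number of positive minus the number of all weights of the path of `P_q * S_r`. -/
noncomputable def excess (d : ℝ) (q r : ℕ) : ℤ :=
  if Odd q then (if 0 < oddWeight d (2 * r + q) then 1 else -1) else 0

theorem two_mul_card_pos_pathWeight (hd0 : 0 < d) (hd4 : d ≤ 1 / 4) (hd : d * n = 2) (hn : 0 < n)
    {q r : ℕ} (h : 2 * r + q ≤ n) :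
    2 * ((Finset.univ.filter
      fun j : Fin q => 0 < pathWeight d r (q - j)).card : ℤ) = q + excess d q r := by
  have e : (Finset.univ.filter fun j : Fin q => 0 < pathWeight d r (q - j)).card =
      ((Finset.range q).filter fun k => 0 < pathWeight d r (k + 1)).card := by
    -- `pathWeight` counts from the far end and `Fin q` from the attachment vertex, hence the
    -- reflection.
    rw [Finset.card_filter, Finset.card_filter, ← Finset.sum_range_reflect,
      Finset.sum_range]
    refine Finset.sum_congr rfl fun j _ => ?_
    rw [show q - 1 - (j : ℕ) + 1 = q - j by omega]
  rw [e, excess]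
  rcases Nat.even_or_odd' q with ⟨t, rfl | rfl⟩
  · rw [card_pos_pathWeight_even hd0 hd4 hd hn t h]
    simp
  · have h1 : pathWeight d r (2 * t + 1) = oddWeight d (2 * r + (2 * t + 1)) := by
      rw [pathWeight, if_pos (by simp)]
    have h2 := card_pos_pathWeight_even hd0 hd4 hd hn t (show 2 * r + 2 * t ≤ n by omega)
    rw [Finset.range_add_one, Finset.filter_insert, if_pos (odd_two_mul_add_one t), ← h1]
    split_ifs
    · rw [Finset.card_insert_of_notMem (by simp), h2]; push_cast; ring
    · rw [h2]; push_cast; ring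

end

/-! ### Upper weights on a whole gpp -/

section

variable {n : ℕ} {d : ℝ} {q r : ℕ}

theorem upperWeight_ne_zero (hd0 : 0 < d) (hd4 : d ≤ 1 / 4) (hd : d * n = 2) (hn : 0 < n)
    (h : 2 * r + q ≤ n) (x : GppVertex q r) : upperWeight d x ≠ 0 := by
  rcases x with j | k | k
  · exact pathWeight_ne_zero hd0 hd4 hd hn (by omega)
  · have : 0 < 1 - 2 * d := by linarith
    exact (one_div_pos.mpr this).ne'
  · have : d - 1 < 0 := by linarith
    exact this.ne

theorem upperWeight_eliminated_le (hd0 : 0 < d) (hd4 : d ≤ 1 / 4) (hd : d * n = 2) (hn : 0 < n)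
    (h : 2 * r + q + 1 ≤ n) (y : GppVertex q r) :
    ∑ x : GppVertex q r, (if x.parent = some y then 1 - 1 / upperWeight d x else 0) + 1 - (2 - d) ≤
      upperWeight d y := by
  rcases y with j | k | k
  · by_cases hj : (j : ℕ) + 1 = q
    · rw [GppVertex.sum_children_path_last _ j hj]
      have : q - (j : ℕ) = 1 := by omega
      simp only [upperWeight, this, pathWeight, odd_one, if_true, oddWeight, one_div, inv_inv,
        Finset.sum_const, Finset.card_univ, Fintype.card_fin, nsmul_eq_mul]
      push_cast
      nlinarith
    · have hj' : (j : ℕ) + 1 < q := by omega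
      rw [GppVertex.sum_children_path _ j hj']
      have := sub_one_div_pathWeight_le hd0 hd4 hd hn (r := r) (k := q - (j + 1)) (by omega)
        (by omega)
      rw [show q - ((j : ℕ) + 1) + 1 = q - j by omega] at this
      simp only [upperWeight]
      linarith
  · rw [GppVertex.sum_children_middle]
    simp only [upperWeight]
    have h1 : 0 < 1 - 2 * d := by linarith
    have h2 : 0 < 1 - d := by linarith
    -- The exact value is d + 1/(1 - d). It is rounded up to 1/(1 - 2d) so that each ray passes on
    -- exactly 2d, that is d for each of its two vertices.
    have h3 : d - 1 / (d - 1) ≤ 1 / (1 - 2 * d) := by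
      rw [← neg_sub 1 d, one_div_neg_eq_neg_one_div, sub_neg_eq_add, le_div_iff₀ h1]
      have : 1 / (1 - d) * (1 - 2 * d) = 1 - d / (1 - d) := by field_simp; ring
      have h4 : d ≤ d / (1 - d) := by rw [le_div_iff₀ h2]; nlinarith
      nlinarith
    linarith
  · rw [GppVertex.sum_children_end]
    simp only [upperWeight]
    linarith

theorem upperWeight_top_le (hd0 : 0 < d) (hd4 : d ≤ 1 / 4) (hd : d * n = 2) (hn : 0 < n)
    (h : 2 * r + q + 1 ≤ n) (hodd : ¬ Odd q) :
    ∑ x : GppVertex q r, (if x.parent = none then 1 - 1 / upperWeight d x else 0) ≤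
      d * (q + 2 * r) := by
  rcases Nat.eq_zero_or_pos q with hq | hq
  · rw [GppVertex.sum_top_of_eq_zero _ hq]
    simp only [upperWeight, one_div, inv_inv, Finset.sum_const, Finset.card_univ,
      Fintype.card_fin, nsmul_eq_mul, hq]
    push_cast
    linarith
  · rw [GppVertex.sum_top_of_pos _ hq]
    exact one_sub_one_div_pathWeight_le hd0 hd4 hd hn hq hodd h

theorem upperWeight_top_of_odd (hodd : Odd q) :
    ∑ x : GppVertex q r, (if x.parent = none then 1 - 1 / upperWeight d x else 0) =
      1 - 1 / oddWeight d (2 * r + q) := by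
  rw [GppVertex.sum_top_of_pos _ hodd.pos]
  simp [upperWeight, pathWeight, hodd]

theorem excess_cases (d : ℝ) (q r : ℕ) :
    excess d q r = 0 ∧ ¬ Odd q ∨ excess d q r = 1 ∧ Odd q ∧ 0 < oddWeight d (2 * r + q) ∨
      excess d q r = -1 ∧ Odd q ∧ oddWeight d (2 * r + q) ≤ 0 := by
  unfold excess
  split_ifs with h1 h2
  · exact Or.inr (Or.inl ⟨rfl, h1, h2⟩)
  · exact Or.inr (Or.inr ⟨rfl, h1, not_lt.mp h2⟩)
  · exact Or.inl ⟨rfl, h1⟩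

end

/-! ### Balance at the attachment vertex and the upper bound -/

/-- A quantitative form of the fact that t + 1/t decreases on (0, 1]: the drop from y to p is (p -
y)(1 - py)/(py), and d ≤ 1/4 makes it at least d². It serves the critical case of one odd gpp with
weight y > 0 and another with weight -p < 0. -/
theorem sub_add_one_div_sub_one_div_le {d y p : ℝ} (hd0 : 0 < d) (hd4 : d ≤ 1 / 4) (hy : 0 < y)
    (hp : 0 < p) (hpy : d - d ^ 2 ≤ p - y) (hp1 : p ≤ 1 - d) :
    p - y + 1 / p - 1 / y + d ^ 2 ≤ 0 := by
  have hyp : y ≤ p := by nlinarith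
  have h4 : p * y ≤ (1 - d) * (1 - d) := mul_le_mul hp1 (by linarith) hy.le (by linarith)
  have h7 : 0 ≤ 2 * d - d ^ 2 := by nlinarith
  have h8 : 2 * d - d ^ 2 ≤ 1 - p * y := by linarith
  have h9 : (d - d ^ 2) * (2 * d - d ^ 2) ≤ (p - y) * (1 - p * y) :=
    mul_le_mul hpy h8 h7 (by linarith)
  have h10 : d ^ 2 ≤ (d - d ^ 2) * (2 * d - d ^ 2) := by
    have : 0 ≤ d ^ 2 * (1 - 3 * d + d ^ 2) := mul_nonneg (sq_nonneg d) (by nlinarith)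
    linarith
  have e : p - y + 1 / p - 1 / y + d ^ 2 =
      (d ^ 2 * (p * y) - (p - y) * (1 - p * y)) / (p * y) := by
    field_simp
    ring
  rw [e]
  refine div_nonpos_of_nonpos_of_nonneg ?_ (by positivity)
  have : d ^ 2 * (p * y) ≤ d ^ 2 * 1 := by gcongr; linarith
  linarith

/-- The excesses of the generalized pendant paths and of the attachment vertex add up to at most
one if the attachment vertex is counted with an excess in `{0, 2}`. -/
theorem sum_excess_add_le {L n : ℕ} {q r : Fin L → ℕ} (hn : ∑ i, (q i + 2 * r i) + 1 = n)
    {d : ℝ} (hd0 : 0 < d) (hd4 : d ≤ 1 / 4) (hd : d * n = 2) {C : Fin L → ℝ}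
    (hC : ∀ i, ¬ Odd (q i) → C i ≤ d * (q i + 2 * r i))
    (hC' : ∀ i, Odd (q i) → C i = 1 - 1 / oddWeight d (2 * r i + q i)) :
    ∑ i, excess d (q i) (r i) + (if 0 < ∑ i, C i - (2 - d) then 2 else 0) ≤ 1 := by
  classical
  have hn0 : 0 < n := by omega
  -- The shares of all gpps together equal the threshold.
  have hsum : ∑ i, d * ((q i : ℝ) + 2 * r i) = 2 - d := by
    have h : ((∑ i, (q i + 2 * r i) + 1 : ℕ) : ℝ) = n := by rw [hn]
    push_cast at h
    rw [← Finset.mul_sum]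
    linear_combination d * h + hd
  have hnn : ∀ i, 0 ≤ d * ((q i : ℝ) + 2 * r i) := fun i => by positivity
  have hodd : ∀ i, d * ((q i : ℝ) + 2 * r i) = oddWeight d (2 * r i + q i) + 1 - d ^ 2 / 2 :=
    fun i => by rw [oddWeight]; push_cast; ring
  by_cases hP : ∃ a, excess d (q a) (r a) = 1
  · obtain ⟨a, ha⟩ := hP
    obtain ⟨-, hao, hay⟩ : excess d (q a) (r a) = 1 ∧ Odd (q a) ∧
        0 < oddWeight d (2 * r a + q a) := by
      rcases excess_cases d (q a) (r a) with h | h | h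
      · omega
      · exact h
      · omega
    have hrest : ∑ i ∈ Finset.univ.erase a, d * ((q i : ℝ) + 2 * r i) =
        2 - d - d * (q a + 2 * r a) := by
      rw [← hsum, ← Finset.add_sum_erase _ _ (Finset.mem_univ a)]; ring
    have hCa := hC' a hao
    have hma := hodd a
    set y := oddWeight d (2 * r a + q a)
    have hle : ∀ i ∈ Finset.univ.erase a, excess d (q i) (r i) ≤ 0 := by
      intro i hi
      rcases excess_cases d (q i) (r i) with h | h | h
      · omega
      -- Excess 1 forces a share above 1 - d²/2; two such shares would exceed the total 2 - d.
      · have h1 := Finset.single_le_sum (fun i _ => hnn i) hi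
        rw [hrest, hodd i] at h1
        nlinarith [h.2.2]
      · omega
    rw [← Finset.add_sum_erase _ _ (Finset.mem_univ a), ha,
      ← Finset.add_sum_erase _ C (Finset.mem_univ a)]
    have hle' := Finset.sum_nonpos hle
    split_ifs with ht
    swap
    · omega
    by_contra! hgt
    -- With a positive weight at the attachment vertex, violating the bound leaves room for at most
    -- one gpp of excess -1 beside `a`. In either case the contributions turn out not to exceed 2 -
    -- d.
    by_cases hN : ∃ b ∈ Finset.univ.erase a, excess d (q b) (r b) ≠ 0
    · obtain ⟨b, hb, hb0⟩ := hN
      obtain ⟨hb1, hbo, hby⟩ : excess d (q b) (r b) = -1 ∧ Odd (q b) ∧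
          oddWeight d (2 * r b + q b) ≤ 0 := by
        have := hle b hb
        rcases excess_cases d (q b) (r b) with h | h | h
        · omega
        · omega
        · exact h
      rw [← Finset.add_sum_erase _ _ hb, hb1] at hgt
      rw [← Finset.add_sum_erase _ _ hb] at ht hrest
      have h0 : ∀ i ∈ (Finset.univ.erase a).erase b, excess d (q i) (r i) = 0 :=
        (Finset.sum_eq_zero_iff_of_nonpos fun i hi => hle i (Finset.mem_of_mem_erase hi)).mp
          (le_antisymm (Finset.sum_nonpos fun i hi => hle i (Finset.mem_of_mem_erase hi))
            (by omega))
      have h2 : ∑ i ∈ (Finset.univ.erase a).erase b, C i ≤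
          ∑ i ∈ (Finset.univ.erase a).erase b, d * ((q i : ℝ) + 2 * r i) :=
        Finset.sum_le_sum fun i hi => hC i (by
          have := h0 i hi
          rcases excess_cases d (q i) (r i) with h | h | h
          · exact h.2
          · omega
          · omega)
      have h3 : 0 ≤ ∑ i ∈ (Finset.univ.erase a).erase b, d * ((q i : ℝ) + 2 * r i) :=
        Finset.sum_nonneg fun i _ => hnn i
      have hmb := hodd b
      have hCb := hC' b hbo
      have hb0' := oddWeight_ne_zero hn0 hd (2 * r b + q b)
      have hp1 : d ≤ d * ((q b : ℝ) + 2 * r b) := by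
        have : (1 : ℝ) ≤ q b := by exact_mod_cast hbo.pos
        nlinarith [(Nat.cast_nonneg (r b) : (0 : ℝ) ≤ r b)]
      obtain ⟨p, hp⟩ : ∃ p, oddWeight d (2 * r b + q b) = -p := ⟨_, (neg_neg _).symm⟩
      rw [hp] at hby hb0' hmb hCb
      have hp0 : 0 < p := lt_of_le_of_ne (by linarith) fun h => hb0' (by rw [← h, neg_zero])
      have hpy : d - d ^ 2 ≤ p - y := by linarith
      have hp2 : p ≤ 1 - d := by nlinarith
      have h6 := sub_add_one_div_sub_one_div_le hd0 hd4 hay hp0 hpy hp2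
      rw [one_div_neg_eq_neg_one_div] at hCb
      linarith
    · push Not at hN
      have h2 : ∑ i ∈ Finset.univ.erase a, C i ≤
          ∑ i ∈ Finset.univ.erase a, d * ((q i : ℝ) + 2 * r i) :=
        Finset.sum_le_sum fun i hi => hC i (by
          have := hN i hi
          rcases excess_cases d (q i) (r i) with h | h | h
          · exact h.2
          · omega
          · omega)
      -- The contribution 1 - 1/y is then at most y - 1, below the share y + 1 - d²/2.
      have h3 : 2 ≤ y + 1 / y := by
        have e : y + 1 / y - 2 = (y - 1) ^ 2 / y := by field_simp; ring
        have : 0 ≤ (y - 1) ^ 2 / y := by positivity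
        linarith
      nlinarith
  · push Not at hP
    have hle : ∀ i ∈ Finset.univ, excess d (q i) (r i) ≤ 0 := by
      intro i _
      have := hP i
      rcases excess_cases d (q i) (r i) with h | h | h <;> omega
    have hle' := Finset.sum_nonpos hle
    split_ifs with ht
    swap
    · omega
    by_contra! hgt
    -- All lengths are even here, so the contributions are bounded by the shares and cannot exceed 2
    -- - d.
    have h0 := (Finset.sum_eq_zero_iff_of_nonpos hle).mp (by omega)
    have : ∑ i, C i ≤ ∑ i, d * ((q i : ℝ) + 2 * r i) :=
      Finset.sum_le_sum fun i hi => hC i (by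
        have := h0 i hi
        rcases excess_cases d (q i) (r i) with h | h | h
        · exact h.2
        · omega
        · omega)
    linarith

theorem two_mul_card_pos_upperWeight {n : ℕ} {d : ℝ} (hd0 : 0 < d) (hd4 : d ≤ 1 / 4)
    (hd : d * n = 2) (hn : 0 < n) {q r : ℕ} (h : 2 * r + q ≤ n) :
    2 * (((Finset.univ.filter fun j => 0 < upperWeight d (.inl j : GppVertex q r)).card +
      ((Finset.univ.filter fun k => 0 < upperWeight d (.inr (.inl k) : GppVertex q r)).card +
      (Finset.univ.filter fun k => 0 < upperWeight d (.inr (.inr k) : GppVertex q r)).card) : ℕ) : ℤ)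
      = (q + 2 * r : ℕ) + excess d q r := by
  have h1 : (Finset.univ.filter fun k => 0 < upperWeight d (.inr (.inl k) : GppVertex q r)).card =
      r := by
    have hm : (0 : ℝ) < 1 / (1 - 2 * d) := one_div_pos.mpr (by linarith)
    exact (congrArg Finset.card (Finset.filter_true_of_mem fun k _ => hm)).trans (by simp)
  have h2 : (Finset.univ.filter fun k => 0 < upperWeight d (.inr (.inr k) : GppVertex q r)).card =
      0 := by
    have he : ¬ 0 < d - 1 := by linarith
    exact (congrArg Finset.card (Finset.filter_false_of_mem fun k _ => he)).trans (by simp)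
  have h3 := two_mul_card_pos_pathWeight hd0 hd4 hd hn h
  rw [h1, h2]
  change 2 * (((Finset.univ.filter fun j : Fin q => 0 < pathWeight d r (q - j)).card + (r + 0) : ℕ) : ℤ)
    = _
  push_cast
  linarith

/-- At most half of the Laplacian eigenvalues of `u + P_{q₁} * S_{r₁} ⊕ ⋯ ⊕ P_{q_L} * S_{r_L}` are
larger than the average degree. -/
theorem sigmaAbove_gppSum_le {L n : ℕ} (q r : Fin L → ℕ) (hn : ∑ i, (q i + 2 * r i) + 1 = n)
    (hn8 : 8 ≤ n) : sigmaAbove (gppSum q r) ≤ n / 2 := by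
  have hn0 : 0 < n := by omega
  have hn' : (8 : ℝ) ≤ n := by exact_mod_cast hn8
  obtain ⟨d, hd⟩ : ∃ d : ℝ, d = 2 / n := ⟨_, rfl⟩
  have hdn : d * n = 2 := by rw [hd]; field_simp
  have hd0 : 0 < d := by rw [hd]; positivity
  have hd4 : d ≤ 1 / 4 := by rw [hd, div_le_iff₀ (by linarith)]; linarith
  have hi : ∀ i, 2 * r i + q i + 1 ≤ n := fun i => by
    have := Finset.single_le_sum (f := fun i => q i + 2 * r i) (fun i _ => Nat.zero_le _)
      (Finset.mem_univ i)
    omega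
  set C : Fin L → ℝ := fun i => ∑ x : GppVertex (q i) (r i),
    (if x.parent = none then 1 - 1 / upperWeight d x else 0) with hC
  have h1 := (gppSum_isParentMap q r).sigmaAbove_le
    (gppSumWeight (fun i => upperWeight d) (∑ i, C i - (2 - d))) (by
      rintro (_ | ⟨i, x⟩) h
      · simp [gppSumParent] at h
      · exact upperWeight_ne_zero hd0 hd4 hdn hn0 (by have := hi i; omega) x) (by
      rw [card_gppSum, hn, ← hd]
      rintro (_ | ⟨i, x⟩)
      · rw [eliminated_none]
        exact le_rfl
      · rw [eliminated_some]
        exact upperWeight_eliminated_le hd0 hd4 hdn hn0 (hi i) x)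
  refine h1.trans ((Nat.le_div_iff_mul_le two_pos).mpr ?_)
  rw [card_pos_gppSumWeight]
  have h2 := sum_excess_add_le hn hd0 hd4 hdn
    (fun i => upperWeight_top_le hd0 hd4 hdn hn0 (hi i)) (fun i h => upperWeight_top_of_odd h)
  have h3 := Finset.sum_congr (rfl : (Finset.univ : Finset (Fin L)) = _) fun i _ =>
    two_mul_card_pos_upperWeight hd0 hd4 hdn hn0
      (show 2 * r i + q i ≤ n by have := hi i; omega)
  rw [Finset.sum_add_distrib, ← Finset.mul_sum, ← Nat.cast_sum, ← Nat.cast_sum] at h3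
  change _ + (if 0 < ∑ i, C i - (2 - d) then (2 : ℤ) else 0) ≤ 1 at h2
  split_ifs at h2 ⊢ <;> omega

/-! ### Lower bound for the prototype trees -/

/-- Lower weights for the generalized pendant path `P_q * S_r` with `q ≤ 1`. -/
noncomputable def lowerWeight (d : ℝ) {q r : ℕ} : GppVertex q r → ℝ
  | .inr (.inl _) => 1
  | _ => d - 1

section

variable {d : ℝ} {q r : ℕ}

theorem lowerWeight_ne_zero (hd : d < 1) (x : GppVertex q r) : lowerWeight d x ≠ 0 := by
  have : d - 1 < 0 := by linarith
  rcases x with j | k | k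
  · exact this.ne
  · exact one_ne_zero
  · exact this.ne

/-- Middle vertices of weight 1 pass on nothing. As q ≤ 1, a path vertex has only such children, so
it keeps the weight d - 1 of a leaf. -/
theorem lowerWeight_le_eliminated (hd0 : 0 < d) (hd : d < 1) (hq : q ≤ 1) (y : GppVertex q r) :
    lowerWeight d y ≤
      ∑ x : GppVertex q r, (if x.parent = some y then 1 - 1 / lowerWeight d x else 0) +
        1 - (2 - d) := by
  rcases y with j | k | k
  · rw [GppVertex.sum_children_path_last _ j (by omega)]
    simp only [lowerWeight]
    simp
    linarith
  · rw [GppVertex.sum_children_middle]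
    simp only [lowerWeight]
    have h1 : 1 ≤ 1 / (1 - d) := by rw [le_div_iff₀ (by linarith)]; linarith
    rw [← neg_sub 1 d, one_div_neg_eq_neg_one_div]
    linarith
  · rw [GppVertex.sum_children_end]
    simp only [lowerWeight]
    linarith

theorem lowerWeight_top_nonneg (hd0 : 0 < d) (hd : d < 1) :
    0 ≤ ∑ x : GppVertex q r, (if x.parent = none then 1 - 1 / lowerWeight d x else 0) := by
  refine Finset.sum_nonneg fun x _ => ?_
  have : 1 / (d - 1) < 0 := one_div_neg.mpr (by linarith)
  split_ifs
  · rcases x with j | k | k <;> simp only [lowerWeight] <;> linarith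
  · exact le_rfl

theorem two_le_lowerWeight_top (hd0 : 0 < d) (hd : d < 1) (hq : 0 < q) :
    2 ≤ ∑ x : GppVertex q r, (if x.parent = none then 1 - 1 / lowerWeight d x else 0) := by
  rw [GppVertex.sum_top_of_pos _ hq]
  simp only [lowerWeight]
  have h1 : 1 ≤ 1 / (1 - d) := by rw [le_div_iff₀ (by linarith)]; linarith
  rw [← neg_sub 1 d, one_div_neg_eq_neg_one_div]
  linarith

end

/-- Every ray contributes an eigenvalue larger than the average degree, and so does the attachment
vertex if one of the paths has positive length. -/
theorem le_sigmaAbove_gppSum {L : ℕ} (q r : Fin L → ℕ) (hq : ∀ i, q i ≤ 1)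
    (hn : 3 ≤ ∑ i, (q i + 2 * r i) + 1) :
    (if ∃ i, q i = 1 then 1 else 0) + ∑ i, r i ≤ sigmaAbove (gppSum q r) := by
  obtain ⟨n, hn'⟩ : ∃ n, n = ∑ i, (q i + 2 * r i) + 1 := ⟨_, rfl⟩
  rw [← hn'] at hn
  have hn3 : (3 : ℝ) ≤ n := by exact_mod_cast hn
  obtain ⟨d, hd⟩ : ∃ d : ℝ, d = 2 / n := ⟨_, rfl⟩
  have hd0 : 0 < d := by rw [hd]; positivity
  have hd1 : d < 1 := by rw [hd, div_lt_one (by linarith)]; linarith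
  -- A path vertex passes on 1 + 1/(1 - d) ≥ 2, which leaves at least d at the attachment vertex;
  -- without one, at least -(2 - d) > -2 remains.
  set t : ℝ := if ∃ i, q i = 1 then d else -2 with ht
  have ht0 : t ≠ 0 := by rw [ht]; split_ifs <;> [exact hd0.ne'; norm_num]
  have h1 := (gppSum_isParentMap q r).le_sigmaAbove
    (gppSumWeight (fun i => lowerWeight d) t) (by
      rintro (_ | ⟨i, x⟩)
      · exact ht0
      · exact lowerWeight_ne_zero hd1 x) (by
      rw [card_gppSum, ← hn', ← hd]
      rintro (_ | ⟨i, x⟩)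
      · rw [eliminated_none]
        change t ≤ _
        rw [ht]
        split_ifs with h
        · obtain ⟨i, hi⟩ := h
          have h2 := Finset.single_le_sum (f := fun i => ∑ x : GppVertex (q i) (r i),
            (if x.parent = none then 1 - 1 / lowerWeight d x else 0))
            (fun i _ => lowerWeight_top_nonneg hd0 hd1) (Finset.mem_univ i)
          have h3 := two_le_lowerWeight_top hd0 hd1 (r := r i) (show 0 < q i by omega)
          simp only [gppSumWeight]
          linarith
        · have h2 := Finset.sum_nonneg (s := Finset.univ) (f := fun i => ∑ x : GppVertex (q i) (r i),
            (if x.parent = none then 1 - 1 / lowerWeight d x else 0))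
            (fun i _ => lowerWeight_top_nonneg hd0 hd1)
          simp only [gppSumWeight]
          linarith
      · rw [eliminated_some]
        exact lowerWeight_le_eliminated hd0 hd1 (hq i) x)
  refine le_trans ?_ h1
  rw [card_pos_gppSumWeight]
  refine add_le_add ?_ (Finset.sum_le_sum fun i _ => ?_)
  · rw [ht]
    split_ifs <;> simp_all
  · simp [lowerWeight]
    omega

theorem card_prototypeTree (r : ℕ) (hr : 1 ≤ r) (α : Fin 4) :
    ∑ i, (prototypeQ α i + 2 * prototypeR r α i) + 1 = 4 * r + α := by
  fin_cases α <;> simp [prototypeQ, prototypeR, Fin.sum_univ_two] <;> omega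

/-- Half of the Laplacian eigenvalues of a prototype tree are larger than its average degree. -/
theorem le_sigmaAbove_prototypeTree (r : ℕ) (hr : 1 ≤ r) (α : Fin 4) :
    (4 * r + α) / 2 ≤ sigmaAbove (prototypeTree r α) := by
  have hq : ∀ i, prototypeQ α i ≤ 1 := by
    intro i
    fin_cases α <;> fin_cases i <;> simp [prototypeQ]
  refine le_trans ?_ (le_sigmaAbove_gppSum _ _ hq (by rw [card_prototypeTree r hr]; omega))
  fin_cases α <;> simp [prototypeQ, prototypeR, Fin.sum_univ_two, Fin.exists_fin_two] <;> omega

/-! ### Trees with a single starlike vertex are sums of gpps -/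

namespace SimpleGraph

variable {V : Type*} {T : SimpleGraph V}

/-- In a tree every vertex has at most one neighbour that is not farther away from `u`. -/
theorem IsTree.eq_of_adj_of_dist_le (hT : T.IsTree) {u w z₁ z₂ : V} (h₁ : T.Adj w z₁)
    (h₂ : T.Adj w z₂) (hd₁ : T.dist u z₁ ≤ T.dist u w) (hd₂ : T.dist u z₂ ≤ T.dist u w) :
    z₁ = z₂ := by
  have key : ∀ z, T.Adj w z → T.dist u z ≤ T.dist u w →
      ∃ P : T.Walk u w, P.IsPath ∧ P.penultimate = z := by
    intro z hz hd
    have hne : T.dist u w = T.dist u z + 1 := by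
      rcases hT.dist_eq_dist_add_one_of_adj u hz with h | h <;> omega
    obtain ⟨P, hP⟩ := hT.connected.exists_walk_length_eq_dist u z
    exact ⟨P.concat hz.symm, Walk.isPath_of_length_eq_dist _ (by simp [hP, hne]), by simp⟩
  obtain ⟨P₁, hP₁, rfl⟩ := key z₁ h₁ hd₁
  obtain ⟨P₂, hP₂, rfl⟩ := key z₂ h₂ hd₂
  rw [(hT.existsUnique_path u w).unique hP₁ hP₂]

end SimpleGraph

namespace GppRepresentation

variable {V : Type*} {T : SimpleGraph V} (R : GppRepresentation T)

/-- A neighbour of a vertex outside all generalized pendant paths lies outside them as well, or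
it belongs to a generalized pendant path attached at that vertex. -/
theorem root_eq_of_adj {w : V} (hw : ∀ i x, R.vert i x ≠ w) {i x} (h : T.Adj w (R.vert i x)) :
    R.root i = w := by
  rcases (R.adj_iff i x w).mp h.symm with h | ⟨y, -, rfl⟩
  · cases hp : x.parent with
    | none => simpa [hp] using h.symm
    | some y => exact absurd (by simpa [hp] using h.symm) (hw i y)
  · exact absurd rfl (hw i y)

/-- If a representation has no starlike vertex other than `u`, then no vertex other than `u` lies
outside the generalized pendant paths. -/
theorem eq_of_forall_isStarlike [Finite V] (hT : T.IsTree) {u : V}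
    (huniq : ∀ w, R.IsStarlike w → w = u) {w : V} (hw : ∀ i x, R.vert i x ≠ w) : w = u := by
  -- Take an outside vertex farthest from `u`: its outside neighbours are not farther away, so in a
  -- tree there is at most one of them.
  obtain ⟨w₀, hw₀, hmax⟩ := Set.Finite.exists_maximalFor (T.dist u)
    {w | ∀ i x, R.vert i x ≠ w} (Set.toFinite _) ⟨w, hw⟩
  have hmax' : ∀ z, (∀ i x, R.vert i x ≠ z) → T.dist u z ≤ T.dist u w₀ := fun z hz => by
    by_contra! h
    exact absurd (hmax hz h.le) (by simpa using h)
  have hw₀u : w₀ = u := by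
    by_contra hne
    have : Nontrivial V := ⟨w₀, u, hne⟩
    obtain ⟨z, hz⟩ := hT.connected.preconnected.exists_adj_of_nontrivial w₀
    -- Otherwise `w₀` would be a leaf, and leaves lie in gpps.
    have hin : ∃ i x, T.Adj w₀ (R.vert i x) := by
      by_contra! hout
      have hone : T.neighborSet w₀ = {z} := by
        refine Set.eq_singleton_iff_unique_mem.mpr ⟨hz, fun z' hz' => ?_⟩
        have hS : ∀ z, T.Adj w₀ z → T.dist u z ≤ T.dist u w₀ := fun z hz =>
          hmax' z fun i x h => hout i x (h ▸ hz)
        exact hT.eq_of_adj_of_dist_le hz' hz (hS _ hz') (hS _ hz)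
      obtain ⟨i, x, hx⟩ := R.leaf_mem w₀ (by rw [hone, Set.ncard_singleton])
      exact hw₀ i x hx
    obtain ⟨i, x, hix⟩ := hin
    have hi : R.root i = w₀ := R.root_eq_of_adj hw₀ hix
    -- A lone gpp at `w₀` would leave two outside neighbours by `collapsed`; two gpps would make
    -- `w₀` a second starlike vertex.
    by_cases hj : ∀ j, R.root j = R.root i → j = i
    · obtain ⟨z₁, z₂, ⟨hz₁, hz₁'⟩, ⟨hz₂, hz₂'⟩, hz⟩ :=
        (Set.one_lt_ncard_iff (Set.toFinite _)).mp (R.collapsed i hj)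
      rw [hi] at hz₁ hz₂
      have hS : ∀ z, T.Adj w₀ z → (∀ x, z ≠ R.vert i x) → T.dist u z ≤ T.dist u w₀ :=
        fun z hz hzi => hmax' z fun j y h => by
          subst h
          obtain rfl := hj j ((R.root_eq_of_adj hw₀ hz).trans hi.symm)
          exact hzi y rfl
      exact hz (hT.eq_of_adj_of_dist_le hz₁ hz₂ (hS _ hz₁ hz₁') (hS _ hz₂ hz₂'))
    · push Not at hj
      obtain ⟨j, hji, hne'⟩ := hj
      exact hne (huniq w₀ ⟨hi ▸ R.three_le_degree i, i, j, hne'.symm, hi, hji.trans hi⟩)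
  have : T.dist u w = 0 := by
    have := hmax' w hw
    rw [hw₀u, SimpleGraph.dist_self] at this
    omega
  exact (hT.connected.dist_eq_zero_iff.mp this).symm

/-- A tree with a representation that has exactly one starlike vertex is the sum of the
generalized pendant paths of the representation. -/
theorem nonempty_iso_gppSum [Finite V] (hT : T.IsTree) (hR : ∃! u : V, R.IsStarlike u) :
    Nonempty (gppSum R.q R.r ≃g T) := by
  obtain ⟨u, -, huniq⟩ := hR
  have hout : ∀ w, (∀ i x, R.vert i x ≠ w) → w = u := fun w hw =>
    R.eq_of_forall_isStarlike hT huniq hw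
  have hroot : ∀ i, R.root i = u := fun i => hout _ fun j x h => R.root_ne i j x h.symm
  have hu' : ∀ i x, R.vert i x ≠ u := fun i x h => R.root_ne i i x ((hroot i).trans h.symm)
  let f : Option (Σ i : Fin R.count, GppVertex (R.q i) (R.r i)) → V :=
    fun v => v.elim u fun x => R.vert x.1 x.2
  have hf : Function.Bijective f := by
    constructor
    · rintro (_ | x) (_ | y) h
      · rfl
      · exact absurd h.symm (hu' y.1 y.2)
      · exact absurd h (hu' x.1 x.2)
      · exact congrArg some (R.injective h)
    · intro w
      by_cases hw : ∀ i x, R.vert i x ≠ w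
      · exact ⟨none, (hout w hw).symm⟩
      · push Not at hw
        obtain ⟨i, x, h⟩ := hw
        exact ⟨some ⟨i, x⟩, h⟩
  have hpar : ∀ i (x : GppVertex (R.q i) (R.r i)),
      x.parent.elim (R.root i) (R.vert i) = f (x.parent.map fun y => ⟨i, y⟩) := by
    intro i x
    cases x.parent with
    | none => exact hroot i
    | some y => rfl
  have hsome : ∀ i (x : GppVertex (R.q i) (R.r i)) v, T.Adj (f (some ⟨i, x⟩)) (f v) ↔
      (gppSum R.q R.r).Adj (some ⟨i, x⟩) v := by
    intro i x v
    rw [(gppSum_isParentMap R.q R.r).adj_iff]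
    refine (R.adj_iff i x (f v)).trans (or_congr ?_ ?_)
    · rw [hpar, hf.1.eq_iff, gppSumParent, Option.some_inj, eq_comm]
    · constructor
      · rintro ⟨y, hy, h⟩
        obtain rfl : v = some ⟨i, y⟩ := hf.1 h
        simp [gppSumParent, hy]
      · intro h
        rcases v with _ | ⟨j, y⟩
        · simp [gppSumParent] at h
        · simp only [gppSumParent, Option.some.injEq, Option.map_eq_some_iff] at h
          obtain ⟨z, hz, h⟩ := h
          cases h
          exact ⟨y, hz, rfl⟩
  refine ⟨⟨Equiv.ofBijective f hf, ?_⟩⟩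
  rintro (_ | ⟨i, x⟩) (_ | ⟨j, y⟩)
  · simp
  · exact (T.adj_comm _ _).trans ((hsome j y none).trans ((gppSum R.q R.r).adj_comm _ _))
  · exact hsome i x none
  · exact hsome i x (some ⟨j, y⟩)

end GppRepresentation
-- Conclusion
theorem mainTheorem8 {V : Type*} [Fintype V] (T : SimpleGraph V) (hT : T.IsTree)
    (n : ℕ) (hn : Fintype.card V = n) (hn8 : 8 ≤ n)
    (R : GppRepresentation T) (hR : ∃! u : V, R.IsStarlike u)
    (α : Fin 4) (hα : n ≡ (α : ℕ) [MOD 4]) :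
    ProperlyTransforms T (prototypeTree (n / 4) α) := by
  have hr : 1 ≤ n / 4 := by omega
  have hnα : 4 * (n / 4) + α = n := by
    have h1 : n % 4 = α % 4 := hα
    have h2 := α.isLt
    omega
  obtain ⟨e⟩ := R.nonempty_iso_gppSum hT hR
  have hcard : ∑ i, (R.q i + 2 * R.r i) + 1 = n := by
    rw [← card_gppSum, Fintype.card_congr e.toEquiv, hn]
  refine ⟨gppSum_isTree _ _, ?_, ?_⟩
  · rw [hn, card_gppSum, card_prototypeTree _ hr, hnα]
  · calc sigmaAbove T = sigmaAbove (gppSum R.q R.r) := (sigmaAbove_congr e).symm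
      _ ≤ n / 2 := sigmaAbove_gppSum_le _ _ hcard hn8
      _ = (4 * (n / 4) + α) / 2 := by rw [hnα]
      _ ≤ sigmaAbove (prototypeTree (n / 4) α) := le_sigmaAbove_prototypeTree _ hr α
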